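/- **Setting.** Let $X$ be a real Banach space whose dual $X^*$ is separable, let $H$ be a Hilbert space over $\mathbb K\in\{\mathbb R,\mathbb C\}$, and identify $X$ with its canonical image in $X^{**}$. Write $\mathbb S_E$ for the unit sphere of a normed space $E$. Let $(b,\omega)\mapsto T_b\omega\colon X^{**}\times H\to H$ be a bilinear map (real-linear in $b$, $\mathbb K$-linear in $\omega$) such that * there are constants $c,C>0$ with $c\|b\|_{X^{**}}\le\|T_b\|_{H\to H}\le C\|b\|_{X^{**}}$ for every $b\in X^{**}$; * $T_b$ is compact for every $b\in X$; * for every $b\in X^{**}$, $T_b$ is self-adjoint and $\|T_b\|_{H\to H}=\sup_{\|f\|_H=1}\langle T_bf,f\rangle$. Define $Q\colon H\to X^*$ by $\langle b,Q\omega\rangle=\langle T_b\omega,\omega\rangle$ for $b\in X$. Let $X_Q$ be the space $X$ with the equivalent norm $\|b\|_{X_Q}=\sup_{\|\omega\|_H=1}\langle b,Q\omega\rangle=\|T_b\|_{H\to H}$, and let $X_Q^*$ be $X^*$ with the dual norm. Put $$\mathscr A=\{\omega\in\mathbb S_H: Q\omega\in\mathbb S_{X_Q^*}\},\qquad D(b)=\{h\in\mathbb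 S_{X_Q^*}:\langle b,h\rangle=1\}\quad(b\in\mathbb S_{X_Q}),\qquad \mathrm{NA}=\bigcup_{b\in\mathbb S_{X_Q}}D(b).$$ **Theorem.** The following statements hold. (i) For every $b\in\mathbb S_{X_Q}$, the set $D(b)$ is convex and has finite affine dimension. (ii) For every $b\in\mathbb S_{X_Q}$, the set $D(b)\cap Q(\mathscr A)$ contains every extreme point of $D(b)$ and is path-connected (in the norm topology). (iii) The relative norm and weak$^*$ topologies coincide on $Q(\mathscr A)$. Let $Q'_\omega\varphi=\lim_{t\to0,\,t\in\mathbb R}\bigl(Q(\omega+t\varphi)-Q\omega\bigr)/t$ be the Gâteaux derivative of $Q$, and suppose in addition that whenever $\omega,\gamma\in\mathscr A$ satisfy $Q\omega=Q\gamma$, there is $c\in\mathbb K$ with $|c|=1$ and $Q'_\omega(c\gamma)\ne0$. Then moreover: (iv) There is a dense, relatively open subset $U$ of $\mathbb S_{X_Q}$ such that for every $b\in U$ we have $D(b)=\{Q\omega\}$ for some $\omega\in\mathscr A$, and the norm $\|\cdot\|_{X_Q}$ is Fréchet differentiable at $b$. (v) $D$ is a cusco map: for every $b\in\mathbb S_{X_Q}$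 the set $D(b)$ is convex, non-empty and norm compact, and for every norm-open $V\subset X_Q^*$ with $D(b)\subset V$ there is a neighbourhood $U$ of $b$ in $\mathbb S_{X_Q}$ such that $D(b')\subset V$ for all $b'\in U$. (vi) The relative norm and weak$^*$ topologies coincide on $\mathrm{NA}$. -/

import Mathlib

open Topology

/-- The standing data: a bilinear map `(b, ω) ↦ T_b ω` from `X** × H` to `H`, where `X` is a real
normed space and `H` is a Hilbert space over `𝕜` (real or complex). It is real-linear in `b` and
each `T_b` is a bounded `𝕜`-linear operator; linearity in `b` is expressed by semilinearity
along `ℝ → 𝕜`, so that no second scalar structure on `H` is needed. -/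
structure QuadSetting (𝕜 : Type*) [RCLike 𝕜]
    (X : Type*) [NormedAddCommGroup X] [NormedSpace ℝ X]
    (H : Type*) [NormedAddCommGroup H] [InnerProductSpace 𝕜 H] [CompleteSpace H] where
  /-- The map `b ↦ T_b`. -/
  T : StrongDual ℝ (StrongDual ℝ X) →ₛₗ[algebraMap ℝ 𝕜] (H →L[𝕜] H)
  /-- Lower bound `c ‖b‖ ≤ ‖T_b‖` with a constant `c > 0`. -/
  lower : ∃ c : ℝ, 0 < c ∧ ∀ b, c * ‖b‖ ≤ ‖T b‖
  /-- Upper bound `‖T_b‖ ≤ C ‖b‖`. -/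
  upper : ∃ C : ℝ, ∀ b, ‖T b‖ ≤ C * ‖b‖
  /-- `T_b` is compact for every `b ∈ X`, where `X` is embedded canonically into `X**`. -/
  compact : ∀ b : X, IsCompactOperator (T (NormedSpace.inclusionInDoubleDual ℝ X b))
  /-- `T_b` is self-adjoint for every `b ∈ X**`. -/
  selfAdjoint : ∀ b, IsSelfAdjoint (T b)
  /-- `‖T_b‖ = sup_{‖f‖ = 1} ⟨T_b f, f⟩`. The inner product is a real number by
  self-adjointness, so that it equals its real part. -/
  norm_eq_iSup : ∀ b,
    ‖T b‖ = ⨆ f : Metric.sphere (0 : H) 1, RCLike.re (inner 𝕜 (T b (f : H)) (f : H))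

namespace QuadSetting

variable {𝕜 : Type*} [RCLike 𝕜]
  {X : Type*} [NormedAddCommGroup X] [NormedSpace ℝ X]
  {H : Type*} [NormedAddCommGroup H] [InnerProductSpace 𝕜 H] [CompleteSpace H]

/-- The operator `T_b` for `b ∈ X`. -/
noncomputable def op (S : QuadSetting 𝕜 X H) (b : X) : H →L[𝕜] H :=
  S.T (NormedSpace.inclusionInDoubleDual ℝ X b)

theorem op_add (S : QuadSetting 𝕜 X H) (a b : X) : S.op (a + b) = S.op a + S.op b := by
  simp [op]

theorem op_smul (S : QuadSetting 𝕜 X H) (r : ℝ) (b : X) :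
    S.op (r • b) = (algebraMap ℝ 𝕜 r) • S.op b := by
  simp only [op, map_smul]
  exact S.T.map_smulₛₗ r _

theorem op_injective (S : QuadSetting 𝕜 X H) {b : X} (h : S.op b = 0) : b = 0 := by
  obtain ⟨c, hc, hb⟩ := S.lower
  have h1 := hb (NormedSpace.inclusionInDoubleDual ℝ X b)
  have h2 : ‖S.T (NormedSpace.inclusionInDoubleDual ℝ X b)‖ = 0 := by
    rw [norm_eq_zero]; exact h
  have h3 : ‖NormedSpace.inclusionInDoubleDual ℝ X b‖ = ‖b‖ :=
    (NormedSpace.inclusionInDoubleDualLi ℝ (E := X)).norm_map b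
  rw [h2, h3] at h1
  have h4 := norm_nonneg b
  exact norm_eq_zero.1 (by nlinarith)

/-- The vector space `X` equipped with the norm `‖b‖ = ‖T_b‖`. The upper and lower bounds make
this norm equivalent to the one of `X`, so that `StrongDual ℝ S.XQ`, with its operator norm, is
`X*` with the dual norm, and its weak* topology is the weak* topology of `X*`. -/
def XQ (_S : QuadSetting 𝕜 X H) : Type _ := X

instance (S : QuadSetting 𝕜 X H) : AddCommGroup S.XQ := inferInstanceAs (AddCommGroup X)

instance (S : QuadSetting 𝕜 X H) : Module ℝ S.XQ := inferInstanceAs (Module ℝ X)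

/-- The identity map from `X_Q` to `X`. -/
def toX (S : QuadSetting 𝕜 X H) : S.XQ ≃ₗ[ℝ] X := LinearEquiv.refl ℝ X

noncomputable instance (S : QuadSetting 𝕜 X H) : NormedAddCommGroup S.XQ :=
  NormedAddCommGroup.induced S.XQ (H →L[𝕜] H)
    (⟨⟨fun b => S.op (S.toX b), by simp [op]⟩, fun a b => by simp [S.op_add]⟩ :
      S.XQ →+ (H →L[𝕜] H))
    ((injective_iff_map_eq_zero _).2 fun b hb => by
      have h : S.toX b = 0 := S.op_injective hb
      simpa using h)

theorem norm_XQ (S : QuadSetting 𝕜 X H) (b : S.XQ) : ‖b‖ = ‖S.op (S.toX b)‖ := rfl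

noncomputable instance (S : QuadSetting 𝕜 X H) : NormedSpace ℝ S.XQ where
  norm_smul_le r b := by
    rw [norm_XQ, norm_XQ, map_smul, op_smul, norm_smul, norm_algebraMap']

/-- The quadratic map `Q : H → X*`, `⟨b, Q ω⟩ = ⟨T_b ω, ω⟩` for `b ∈ X`, with values in the dual
of `X_Q`. -/
noncomputable def Q (S : QuadSetting 𝕜 X H) (ω : H) : StrongDual ℝ S.XQ :=
  LinearMap.mkContinuous
    { toFun := fun b => RCLike.re (inner 𝕜 (S.op (S.toX b) ω) ω)
      map_add' := fun a b => by simp [S.op_add, inner_add_left]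
      map_smul' := fun r b => by
        rw [map_smul, op_smul]
        simp [inner_smul_left] }
    (‖ω‖ * ‖ω‖)
    (fun b => by
      refine (RCLike.abs_re_le_norm _).trans ((norm_inner_le_norm _ _).trans ?_)
      have h := (S.op (S.toX b)).le_opNorm ω
      rw [norm_XQ]
      nlinarith [norm_nonneg ω])

theorem Q_apply (S : QuadSetting 𝕜 X H) (ω : H) (b : S.XQ) :
    S.Q ω b = RCLike.re (inner 𝕜 (S.op (S.toX b) ω) ω) := rfl

/-- The norm of `X_Q` is `sup_{‖ω‖ = 1} ⟨b, Q ω⟩`. -/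
theorem norm_XQ_eq_iSup (S : QuadSetting 𝕜 X H) (b : S.XQ) :
    ‖b‖ = ⨆ ω : Metric.sphere (0 : H) 1, S.Q (ω : H) b :=
  S.norm_eq_iSup _

/-- The set `𝒜` of unit vectors `ω` of `H` such that `Q ω` is a unit vector of `X_Q*`. -/
def A (S : QuadSetting 𝕜 X H) : Set H :=
  {ω | ‖ω‖ = 1 ∧ ‖S.Q ω‖ = 1}

/-- The Gâteaux derivative `Q'_ω φ`, the limit of `(Q (ω + t φ) - Q ω) / t` as the real number
`t` tends to `0` (in the norm of `X_Q*`). -/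
noncomputable def Q' (S : QuadSetting 𝕜 X H) (ω φ : H) : StrongDual ℝ S.XQ :=
  deriv (fun t : ℝ => S.Q (ω + (t : 𝕜) • φ)) 0

/-- The extra assumption: if `ω, γ ∈ 𝒜` and `Q ω = Q γ`, then `Q'_ω (c γ) ≠ 0` for some scalar
`c` with `|c| = 1`. -/
def Nondegenerate (S : QuadSetting 𝕜 X H) : Prop :=
  ∀ ω ∈ S.A, ∀ γ ∈ S.A, S.Q ω = S.Q γ → ∃ c : 𝕜, ‖c‖ = 1 ∧ S.Q' ω (c • γ) ≠ 0

end QuadSetting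

/-- The duality mapping of a real normed space `E`: for `b` in the unit sphere of `E`, the set of
all `h` in the unit sphere of `E*` with `⟨b, h⟩ = 1`. -/
def dualityMap {E : Type*} [NormedAddCommGroup E] [NormedSpace ℝ E]
    (b : Metric.sphere (0 : E) 1) : Set (StrongDual ℝ E) :=
  {h | ‖h‖ = 1 ∧ h (b : E) = 1}

/-- The set of norm-attaining functionals in the unit sphere of `E*`. -/
def normAttaining (E : Type*) [NormedAddCommGroup E] [NormedSpace ℝ E] :
    Set (StrongDual ℝ E) :=
  ⋃ b : Metric.sphere (0 : E) 1, dualityMap b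

/-- The relative norm topology and the relative weak* topology coincide on `s ⊆ E*`. -/
def NormEqWeakStarOn {E : Type*} [NormedAddCommGroup E] [NormedSpace ℝ E]
    (s : Set (StrongDual ℝ E)) : Prop :=
  TopologicalSpace.induced (fun f : s => (f : StrongDual ℝ E)) inferInstance =
    TopologicalSpace.induced (fun f : s => StrongDual.toWeakDual (f : StrongDual ℝ E))
      inferInstance

/-- A set-valued map is cusco: its values are convex, nonempty and compact, and it is upper
semicontinuous. -/
def IsCusco {Y Z : Type*} [TopologicalSpace Y] [TopologicalSpace Z] [AddCommGroup Z] [Module ℝ Z]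
    (F : Y → Set Z) : Prop :=
  ∀ y, Convex ℝ (F y) ∧ (F y).Nonempty ∧ IsCompact (F y) ∧
    ∀ V : Set Z, IsOpen V → F y ⊆ V → ∃ U ∈ 𝓝 y, ∀ y' ∈ U, F y' ⊆ V

/-! ### Weak compactness in Hilbert space. -/

section
open Filter

/-! For `‖b‖ = 1` in `X_Q`, the operator `T_b` is compact, self-adjoint and of norm 1, and its norm
is the supremum of its quadratic form. So the supremum is attained, exactly at the unit vectors of
the eigenspace for the eigenvalue 1 (`topSphere b`), which is finite-dimensional.

Everything rests on one compactness principle. Weak limits of unit vectors exist, and compactness of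
`T_b` makes `ω ↦ Q ω b` continuous along them. Since `‖Q ω‖ ≤ ‖ω‖ ^ 2`, a weak limit `ω'` with `Q ω'
b = 1` or `‖Q ω'‖ = 1` has lost no norm, and the convergence is strong (`exists_limit`,
`exists_tendsto_topSphere`). This gives (iii). Combined with Hahn–Banach and maximisers of `b + t x`
as `t → 0+`, it gives `D(b) = conv Q(topSphere b)`, from which (i) and (ii) are read off.

For (v), (vi) and the differentiability in (iv), the principle is made uniform: an element `h` of
the convex hull of `Q(sphere)` with `h b` close to 1 is norm-close to `D(b)`
(`exists_delta_dualityMap`).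

For (iv), the multiplicity of the eigenvalue 1 is upper semicontinuous in `b`. At a local minimum of
the multiplicity, the eigenspaces of nearby operators fill the whole limiting eigenspace, so
first-order perturbation forces `Q` to be constant on `topSphere b`. By polarisation and
nondegeneracy this is impossible in dimension at least 2. Hence multiplicity 1 is generic, and there
`D(b)` is a point. -/

theorem Ultrafilter.exists_inner_tendsto {𝕜 H : Type*} [RCLike 𝕜]
    [NormedAddCommGroup H] [InnerProductSpace 𝕜 H] [CompleteSpace H] {ι : Type*}
    (u : Ultrafilter ι) {ω : ι → H} (hω : ∀ᶠ i in u, ‖ω i‖ ≤ 1) :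
    ∃ ω' : H, ‖ω'‖ ≤ 1 ∧
      ∀ x, Tendsto (fun i => inner 𝕜 (ω i) x) u (𝓝 (inner 𝕜 ω' x)) := by
  let j : H → WeakDual 𝕜 H := fun x => StrongDual.toWeakDual (InnerProductSpace.toDual 𝕜 H x)
  have hK := WeakDual.isCompact_closedBall (𝕜 := 𝕜) (E := H) 0 1
  obtain ⟨f, hf, hlim⟩ := hK.ultrafilter_le_nhds (u.map (j ∘ ω)) (by
    rw [le_principal_iff, Ultrafilter.coe_map, Filter.mem_map]
    filter_upwards [hω] with i hi
    simpa [j] using hi)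
  refine ⟨(InnerProductSpace.toDual 𝕜 H).symm (WeakDual.toStrongDual f), by simpa using hf,
    fun x => ?_⟩
  have h1 : Tendsto (fun i => j (ω i)) u (𝓝 f) := hlim
  have h2 := ((WeakDual.eval_continuous (𝕜 := 𝕜) (E := H) x).tendsto f).comp h1
  simpa [j, Function.comp_def] using h2

/-- The images stay in a compact set, so they converge along the ultrafilter; moving `T` across the
inner product by its adjoint identifies the limit. -/
theorem IsCompactOperator.tendsto_of_inner_tendsto {𝕜 H : Type*} [RCLike 𝕜]
    [NormedAddCommGroup H] [InnerProductSpace 𝕜 H] [CompleteSpace H]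
    {ι : Type*} {u : Ultrafilter ι} {ω : ι → H} {ω' : H}
    (hω : ∀ᶠ i in u, ‖ω i‖ ≤ 1)
    (hlim : ∀ x, Tendsto (fun i => inner 𝕜 (ω i) x) u (𝓝 (inner 𝕜 ω' x)))
    {T : H →L[𝕜] H} (hT : IsCompactOperator T) :
    Tendsto (fun i => T (ω i)) u (𝓝 (T ω')) := by
  have hK := IsCompactOperator.isCompact_closure_image_closedBall (f := (T : H →ₗ[𝕜] H)) hT 1
  obtain ⟨y, -, hy⟩ := hK.ultrafilter_le_nhds (u.map (fun i => T (ω i))) (by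
    rw [le_principal_iff, Ultrafilter.coe_map, Filter.mem_map]
    filter_upwards [hω] with i hi
    exact subset_closure ⟨ω i, by simpa using hi, rfl⟩)
  have hy' : Tendsto (fun i => T (ω i)) u (𝓝 y) := hy
  suffices y = T ω' by rwa [← this]
  refine ext_inner_right 𝕜 fun x => ?_
  refine tendsto_nhds_unique (hy'.inner (tendsto_const_nhds (x := x))) ?_
  simp_rw [← ContinuousLinearMap.adjoint_inner_right]
  exact hlim _

end

/-! ### The polar form of `Q` and the top eigenvectors of `T_b`. -/

namespace QuadSetting
open Filter

variable {𝕜 : Type*} [RCLike 𝕜]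
  {X : Type*} [NormedAddCommGroup X] [NormedSpace ℝ X]
  {H : Type*} [NormedAddCommGroup H] [InnerProductSpace 𝕜 H] [CompleteSpace H]

/-- The operator `T_b` for `b ∈ X_Q`. -/
noncomputable def opQ (S : QuadSetting 𝕜 X H) (b : S.XQ) : H →L[𝕜] H := S.op (S.toX b)

theorem opQ_add (S : QuadSetting 𝕜 X H) (a b : S.XQ) : S.opQ (a + b) = S.opQ a + S.opQ b := by
  simp [opQ, op_add]

theorem opQ_smul (S : QuadSetting 𝕜 X H) (r : ℝ) (b : S.XQ) :
    S.opQ (r • b) = (r : 𝕜) • S.opQ b := by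
  simp [opQ, op_smul]

theorem norm_opQ (S : QuadSetting 𝕜 X H) (b : S.XQ) : ‖S.opQ b‖ = ‖b‖ := rfl

theorem isCompactOperator_opQ (S : QuadSetting 𝕜 X H) (b : S.XQ) :
    IsCompactOperator (S.opQ b) := S.compact _

theorem inner_opQ_left (S : QuadSetting 𝕜 X H) (b : S.XQ) (x y : H) :
    inner 𝕜 (S.opQ b x) y = inner 𝕜 x (S.opQ b y) :=
  (S.selfAdjoint _).isSymmetric x y

/-- The symmetric real-bilinear map polarising `Q`. -/
noncomputable def polar (S : QuadSetting 𝕜 X H) (ω φ : H) : StrongDual ℝ S.XQ :=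
  LinearMap.mkContinuous
    { toFun := fun b => RCLike.re (inner 𝕜 (S.opQ b ω) φ)
      map_add' := fun a b => by simp [S.opQ_add, inner_add_left]
      map_smul' := fun r b => by simp [opQ_smul, inner_smul_left] }
    (‖ω‖ * ‖φ‖)
    (fun b => by
      refine (RCLike.abs_re_le_norm _).trans ((norm_inner_le_norm _ _).trans ?_)
      have h := (S.opQ b).le_opNorm ω
      rw [norm_opQ] at h
      nlinarith [norm_nonneg φ])

theorem polar_apply (S : QuadSetting 𝕜 X H) (ω φ : H) (b : S.XQ) :
    S.polar ω φ b = RCLike.re (inner 𝕜 (S.opQ b ω) φ) := rfl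

theorem Q_eq_polar (S : QuadSetting 𝕜 X H) (ω : H) : S.Q ω = S.polar ω ω := rfl

theorem norm_polar_le (S : QuadSetting 𝕜 X H) (ω φ : H) : ‖S.polar ω φ‖ ≤ ‖ω‖ * ‖φ‖ :=
  LinearMap.mkContinuous_norm_le _ (by positivity) _

theorem polar_comm (S : QuadSetting 𝕜 X H) (ω φ : H) : S.polar ω φ = S.polar φ ω := by
  ext b
  rw [polar_apply, polar_apply, inner_opQ_left, ← inner_conj_symm, RCLike.conj_re]

theorem polar_add_left (S : QuadSetting 𝕜 X H) (ω ω' φ : H) :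
    S.polar (ω + ω') φ = S.polar ω φ + S.polar ω' φ := by
  ext b; simp [polar_apply, inner_add_left]

theorem polar_add_right (S : QuadSetting 𝕜 X H) (ω φ φ' : H) :
    S.polar ω (φ + φ') = S.polar ω φ + S.polar ω φ' := by
  ext b; simp [polar_apply, inner_add_right]

theorem polar_smul_left (S : QuadSetting 𝕜 X H) (r : ℝ) (ω φ : H) :
    S.polar ((r : 𝕜) • ω) φ = r • S.polar ω φ := by
  ext b; simp [polar_apply, inner_smul_left]

theorem polar_smul_right (S : QuadSetting 𝕜 X H) (r : ℝ) (ω φ : H) :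
    S.polar ω ((r : 𝕜) • φ) = r • S.polar ω φ := by
  ext b; simp [polar_apply, inner_smul_right]

theorem Q_add (S : QuadSetting 𝕜 X H) (ω φ : H) :
    S.Q (ω + φ) = S.Q ω + (2 : ℝ) • S.polar ω φ + S.Q φ := by
  simp only [Q_eq_polar, polar_add_left, polar_add_right, S.polar_comm φ ω, two_smul]
  abel

theorem Q_real_smul (S : QuadSetting 𝕜 X H) (r : ℝ) (ω : H) :
    S.Q ((r : 𝕜) • ω) = r ^ 2 • S.Q ω := by
  rw [Q_eq_polar, polar_smul_left, polar_smul_right, smul_smul, ← pow_two, ← Q_eq_polar]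

theorem Q_smul_of_norm_one (S : QuadSetting 𝕜 X H) {c : 𝕜} (hc : ‖c‖ = 1) (ω : H) :
    S.Q (c • ω) = S.Q ω := by
  ext b
  rw [Q_eq_polar, polar_apply, Q_eq_polar, polar_apply, map_smul, inner_smul_left,
    inner_smul_right, ← mul_assoc, RCLike.conj_mul, hc]
  simp

theorem norm_Q_le (S : QuadSetting 𝕜 X H) (ω : H) : ‖S.Q ω‖ ≤ ‖ω‖ ^ 2 := by
  rw [pow_two]; exact S.norm_polar_le ω ω

theorem norm_Q_sub_le (S : QuadSetting 𝕜 X H) (ω γ : H) :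
    ‖S.Q ω - S.Q γ‖ ≤ ‖ω - γ‖ * (‖ω‖ + ‖γ‖) := by
  have h : S.Q ω - S.Q γ = S.polar (ω - γ) (ω + γ) := by
    have h1 : S.polar (ω - γ) (ω + γ) + S.polar γ (ω + γ) = S.polar ω (ω + γ) := by
      rw [← polar_add_left, sub_add_cancel]
    rw [eq_sub_of_add_eq h1, polar_add_right, polar_add_right, S.polar_comm γ ω,
      Q_eq_polar, Q_eq_polar]
    abel
  rw [h]
  exact (S.norm_polar_le _ _).trans (by gcongr; exact norm_add_le _ _)

theorem continuous_Q (S : QuadSetting 𝕜 X H) : Continuous S.Q := by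
  rw [continuous_iff_continuousAt]
  intro γ
  rw [ContinuousAt, tendsto_iff_norm_sub_tendsto_zero]
  have h : Tendsto (fun ω => ‖ω - γ‖ * (‖ω‖ + ‖γ‖)) (𝓝 γ) (𝓝 (‖γ - γ‖ * (‖γ‖ + ‖γ‖))) :=
    Continuous.tendsto (by fun_prop) γ
  rw [sub_self, norm_zero, zero_mul] at h
  exact squeeze_zero (fun _ => norm_nonneg _) (fun ω => S.norm_Q_sub_le ω γ) h

theorem Q_apply_le (S : QuadSetting 𝕜 X H) {ω : H} (hω : ‖ω‖ = 1) (b : S.XQ) :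
    S.Q ω b ≤ ‖b‖ := by
  have h := (S.Q ω).le_opNorm b
  have h2 := S.norm_Q_le ω
  rw [hω, one_pow] at h2
  calc S.Q ω b ≤ ‖S.Q ω b‖ := le_abs_self _
    _ ≤ _ := h
    _ ≤ 1 * ‖b‖ := by gcongr
    _ = ‖b‖ := one_mul _

/-- The set of unit eigenvectors of `T_b` for the eigenvalue `1`. -/
def topSphere (S : QuadSetting 𝕜 X H) (b : S.XQ) : Set H :=
  {ω | ‖ω‖ = 1 ∧ S.opQ b ω = ω}

/-- Equality case of Cauchy–Schwarz: `‖T_b ω - ω‖² ≤ 1 - 2 + 1 = 0`. -/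
theorem mem_topSphere_iff (S : QuadSetting 𝕜 X H) {b : S.XQ} (hb : ‖b‖ = 1) {ω : H} :
    ω ∈ S.topSphere b ↔ ‖ω‖ = 1 ∧ S.Q ω b = 1 := by
  refine and_congr_right fun hω => ⟨fun h => ?_, fun h => ?_⟩
  · rw [Q_eq_polar, polar_apply, h, inner_self_eq_norm_sq, hω, one_pow]
  · have h1 : ‖S.opQ b ω - ω‖ ^ 2 = ‖S.opQ b ω‖ ^ 2 - 2 * S.Q ω b + 1 := by
      rw [@norm_sub_sq 𝕜, hω, one_pow]; rfl
    have h2 : ‖S.opQ b ω‖ ≤ 1 := by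
      have := (S.opQ b).le_opNorm ω
      rwa [norm_opQ, hb, hω, one_mul] at this
    rw [h] at h1
    have h3 : ‖S.opQ b ω - ω‖ ^ 2 ≤ 0 := by nlinarith [norm_nonneg (S.opQ b ω)]
    have h4 : ‖S.opQ b ω - ω‖ = 0 := by nlinarith [norm_nonneg (S.opQ b ω - ω)]
    exact sub_eq_zero.1 (norm_eq_zero.1 h4)

theorem exists_limit (S : QuadSetting 𝕜 X H) {ι : Type*} (u : Ultrafilter ι) {ω : ι → H}
    (hω : ∀ᶠ i in u, ‖ω i‖ = 1) :
    ∃ ω' : H, ‖ω'‖ ≤ 1 ∧ (∀ b, Tendsto (fun i => S.Q (ω i) b) u (𝓝 (S.Q ω' b))) ∧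
      (1 ≤ ‖ω'‖ → Tendsto ω u (𝓝 ω')) := by
  obtain ⟨ω', h1, hlim⟩ := u.exists_inner_tendsto (𝕜 := 𝕜) (hω.mono fun _ h => h.le)
  refine ⟨ω', h1, fun b => ?_, fun h => ?_⟩
  · have hT := IsCompactOperator.tendsto_of_inner_tendsto (hω.mono fun _ h => h.le) hlim
      (S.isCompactOperator_opQ b)
    have hA : Tendsto (fun i => inner 𝕜 (ω i) (S.opQ b (ω i) - S.opQ b ω')) u (𝓝 0) := by
      refine squeeze_zero_norm' (hω.mono fun i hi => ?_) (tendsto_iff_norm_sub_tendsto_zero.1 hT)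
      refine (norm_inner_le_norm _ _).trans ?_
      rw [hi, one_mul]
    have hB := hA.add (hlim (S.opQ b ω'))
    simp_rw [← inner_add_right, sub_add_cancel, zero_add, ← inner_opQ_left] at hB
    exact (RCLike.continuous_re.tendsto _).comp hB
  · have h2 : ‖ω'‖ = 1 := le_antisymm h1 h
    rw [tendsto_iff_norm_sub_tendsto_zero]
    have h3 : Tendsto (fun i => 2 - 2 * RCLike.re (inner 𝕜 (ω i) ω')) u (𝓝 0) := by
      have := ((RCLike.continuous_re.tendsto _).comp (hlim ω')).const_mul 2 |>.const_sub 2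
      rw [inner_self_eq_norm_sq, h2] at this
      norm_num at this
      exact this
    have h4 : Tendsto (fun i => ‖ω i - ω'‖ ^ 2) u (𝓝 0) := by
      refine h3.congr' (hω.mono fun i hi => ?_)
      change _ = ‖ω i - ω'‖ ^ 2
      rw [@norm_sub_sq 𝕜, hi, h2]
      ring
    have h5 := (Real.continuous_sqrt.tendsto _).comp h4
    simpa [Function.comp_def, Real.sqrt_sq] using h5

/-- Almost maximisers converge in norm: the weak limit satisfies `1 = Q ω' b ≤ ‖ω'‖ ^ 2`, so no norm
is lost. -/
theorem exists_tendsto_topSphere (S : QuadSetting 𝕜 X H) {b : S.XQ} (hb : ‖b‖ = 1)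
    {ι : Type*} (u : Ultrafilter ι) {ω : ι → H} (hω : ∀ᶠ i in u, ‖ω i‖ = 1)
    (hQ : Tendsto (fun i => S.Q (ω i) b) u (𝓝 1)) :
    ∃ ω' ∈ S.topSphere b, Tendsto ω u (𝓝 ω') := by
  obtain ⟨ω', h1, h2, h3⟩ := S.exists_limit u hω
  have h4 : S.Q ω' b = 1 := tendsto_nhds_unique (h2 b) hQ
  have h5 : 1 ≤ ‖ω'‖ := by
    have h := (le_abs_self _).trans ((S.Q ω').le_opNorm b)
    rw [h4, hb, mul_one] at h
    nlinarith [S.norm_Q_le ω', norm_nonneg ω']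
  exact ⟨ω', (S.mem_topSphere_iff hb).2 ⟨le_antisymm h1 h5, h4⟩, h3 h5⟩

theorem topSphere_nonempty (S : QuadSetting 𝕜 X H) {b : S.XQ} (hb : ‖b‖ = 1) :
    (S.topSphere b).Nonempty := by
  have hne : Nonempty (Metric.sphere (0 : H) 1) := by
    by_contra hne
    rw [not_nonempty_iff] at hne
    have h := S.norm_XQ_eq_iSup b
    -- The real supremum over an empty index is 0 by convention, so a trivial `H` would give `‖b‖ =
    -- 0`.
    rw [Real.iSup_of_isEmpty, hb] at h
    exact one_ne_zero h
  have h : ∀ n : ℕ, ∃ ω : H, ‖ω‖ = 1 ∧ 1 - 1 / ((n : ℝ) + 1) < S.Q ω b := fun n => by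
    have hlt : 1 - 1 / ((n : ℝ) + 1) < ⨆ ω : Metric.sphere (0 : H) 1, S.Q (ω : H) b := by
      rw [← norm_XQ_eq_iSup, hb, sub_lt_self_iff]
      positivity
    obtain ⟨ω, hω⟩ := exists_lt_of_lt_ciSup hlt
    exact ⟨ω, by simp, hω⟩
  choose ω h1 h2 using h
  have hQ : Tendsto (fun n => S.Q (ω n) b) atTop (𝓝 1) := by
    refine tendsto_of_tendsto_of_tendsto_of_le_of_le ?_ tendsto_const_nhds (fun n => (h2 n).le)
      (fun n => hb ▸ S.Q_apply_le (h1 n) b)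
    simpa using tendsto_one_div_add_atTop_nhds_zero_nat.const_sub (1 : ℝ)
  obtain ⟨ω', h3, -⟩ := S.exists_tendsto_topSphere hb (hyperfilter ℕ) (.of_forall h1)
    (hQ.mono_left Nat.hyperfilter_le_atTop)
  exact ⟨ω', h3⟩

theorem isCompact_topSphere (S : QuadSetting 𝕜 X H) {b : S.XQ} (hb : ‖b‖ = 1) :
    IsCompact (S.topSphere b) := by
  rw [isCompact_iff_ultrafilter_le_nhds]
  intro u hu
  have hu' : ∀ᶠ ω in u, ω ∈ S.topSphere b := le_principal_iff.1 hu
  refine S.exists_tendsto_topSphere hb u (ω := id) (hu'.mono fun ω h => h.1) ?_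
  exact tendsto_const_nhds.congr' (hu'.mono fun ω h => (((S.mem_topSphere_iff hb).1 h).2).symm)

end QuadSetting

/-! ### Convex hulls of compact sets and weak* separation. -/

/-- By Carathéodory at most `finrank F + 1` points are needed, so the hull is a finite union of
continuous images of products of a simplex with powers of `K`. -/
theorem IsCompact.convexHull_of_subset_submodule {E : Type*} [AddCommGroup E] [Module ℝ E]
    [TopologicalSpace E] [ContinuousAdd E] [ContinuousSMul ℝ E] {K : Set E} (hK : IsCompact K)
    {F : Submodule ℝ E} [FiniteDimensional ℝ F] (hKF : K ⊆ F) : IsCompact (convexHull ℝ K) := by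
  have key : convexHull ℝ K = ⋃ m ∈ Finset.range (Module.finrank ℝ F + 2),
      (fun p : (Fin m → ℝ) × (Fin m → E) => ∑ i, p.1 i • p.2 i) ''
        (stdSimplex ℝ (Fin m) ×ˢ Set.pi Set.univ fun _ => K) := by
    apply Set.Subset.antisymm
    · intro x hx
      obtain ⟨ι, _, z, w, hz, hind, hw, hw1, rfl⟩ := eq_pos_convex_span_of_mem_convexHull hx
      have hle : vectorSpan ℝ (Set.range z) ≤ F :=
        Submodule.span_le.2 (by
          rintro _ ⟨a, ha, c, hc, rfl⟩
          exact F.sub_mem (hKF (hz ha)) (hKF (hz hc)))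
      have hfin := Submodule.finiteDimensional_of_le hle
      have hcard := hind.card_le_finrank_succ
      have hmono := Submodule.finrank_mono hle
      simp only [Set.mem_iUnion, Finset.mem_range]
      refine ⟨Fintype.card ι, by omega,
        ⟨fun i => w ((Fintype.equivFin ι).symm i), fun i => z ((Fintype.equivFin ι).symm i)⟩,
        ⟨⟨fun i => (hw _).le, ?_⟩, fun i _ => hz ⟨_, rfl⟩⟩, ?_⟩
      · exact (Equiv.sum_comp (Fintype.equivFin ι).symm w).trans hw1
      · exact Equiv.sum_comp (Fintype.equivFin ι).symm fun i => w i • z i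
    · simp only [Set.iUnion_subset_iff]
      rintro m - _ ⟨⟨w, z⟩, ⟨hw, hz⟩, rfl⟩
      exact (convex_convexHull ℝ K).sum_mem (fun i _ => hw.1 i) hw.2
        fun i _ => subset_convexHull ℝ K (hz i trivial)
  rw [key]
  refine (Finset.range _).isCompact_biUnion fun m _ => IsCompact.image ?_ (by fun_prop)
  exact (isCompact_stdSimplex ℝ (Fin m)).prod (isCompact_univ_pi fun _ => hK)

/-- A norm-compact set is weak* compact, hence weak* closed, and weak* continuous functionals are
evaluations; so the separating functional is a point of `E` itself. -/
theorem StrongDual.exists_lt_of_notMem_isCompact {E : Type*} [NormedAddCommGroup E]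
    [NormedSpace ℝ E] {C : Set (StrongDual ℝ E)} (hC : Convex ℝ C) (hC' : IsCompact C)
    {h : StrongDual ℝ E} (hh : h ∉ C) : ∃ (x : E) (r : ℝ), (∀ g ∈ C, g x < r) ∧ r < h x := by
  let j : StrongDual ℝ E →ₗ[ℝ] WeakBilin (topDualPairing ℝ E) := LinearMap.id
  have hj : Continuous j := NormedSpace.Dual.toWeakDual_continuous
  have hT2 : T2Space (WeakBilin (topDualPairing ℝ E)) :=
    inferInstanceAs (T2Space (WeakDual ℝ E))
  obtain ⟨f, r, h1, h2⟩ := geometric_hahn_banach_closed_point (s := j '' C) (x := j h)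
    (hC.linear_image j) (hC'.image hj).isClosed (by
      rintro ⟨g, hg, hgh⟩
      have hgh' : g = h := hgh
      exact hh (hgh' ▸ hg))
  obtain ⟨x, hx⟩ := LinearMap.dualEmbedding_surjective (topDualPairing ℝ E) f
  refine ⟨x, r, fun g hg => ?_, ?_⟩
  · have := h1 _ ⟨g, hg, rfl⟩
    rw [← hx] at this
    exact this
  · rw [← hx] at h2
    exact h2

theorem mem_dualityMap_iff {E : Type*} [NormedAddCommGroup E] [NormedSpace ℝ E]
    (b : Metric.sphere (0 : E) 1) (h : StrongDual ℝ E) :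
    h ∈ dualityMap b ↔ ‖h‖ ≤ 1 ∧ h (b : E) = 1 := by
  refine ⟨fun hh => ⟨hh.1.le, hh.2⟩, fun hh => ⟨le_antisymm hh.1 ?_, hh.2⟩⟩
  have := (le_abs_self _).trans (h.le_opNorm (b : E))
  rwa [hh.2, norm_eq_of_mem_sphere, mul_one] at this

theorem convex_dualityMap {E : Type*} [NormedAddCommGroup E] [NormedSpace ℝ E]
    (b : Metric.sphere (0 : E) 1) : Convex ℝ (dualityMap b) := by
  have h : dualityMap b = Metric.closedBall 0 1 ∩ {h : StrongDual ℝ E | h (b : E) = 1} := by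
    ext h; simp [mem_dualityMap_iff]
  rw [h]
  refine (convex_closedBall 0 1).inter ?_
  intro f hf g hg s t _ _ hst
  simp only [Set.mem_ofPred_eq] at hf hg ⊢
  simp [hf, hg, hst]

/-! ### The face `D(b)` as the convex hull of `Q` on the top eigenvectors. -/

namespace QuadSetting
open Filter

variable {𝕜 : Type*} [RCLike 𝕜]
  {X : Type*} [NormedAddCommGroup X] [NormedSpace ℝ X]
  {H : Type*} [NormedAddCommGroup H] [InnerProductSpace 𝕜 H] [CompleteSpace H]

/-- The vector `b` serves only to supply a unit vector of `H` when `a = 0`. -/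
theorem exists_Q_apply_eq_norm (S : QuadSetting 𝕜 X H) {b : S.XQ} (hb : ‖b‖ = 1) (a : S.XQ) :
    ∃ ω : H, ‖ω‖ = 1 ∧ S.Q ω a = ‖a‖ := by
  by_cases ha : a = 0
  · obtain ⟨ω, hω⟩ := S.topSphere_nonempty hb
    exact ⟨ω, hω.1, by simp [ha]⟩
  · have ha' : ‖a‖ ≠ 0 := norm_ne_zero_iff.2 ha
    have h1 : ‖(‖a‖⁻¹ • a : S.XQ)‖ = 1 := by
      rw [norm_smul, norm_inv, norm_norm, inv_mul_cancel₀ ha']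
    obtain ⟨ω, hω⟩ := S.topSphere_nonempty h1
    obtain ⟨h2, h3⟩ := (S.mem_topSphere_iff h1).1 hω
    refine ⟨ω, h2, ?_⟩
    rw [map_smul, smul_eq_mul] at h3
    field_simp at h3
    exact h3

theorem Q_mem_dualityMap (S : QuadSetting 𝕜 X H) (b : Metric.sphere (0 : S.XQ) 1) {ω : H}
    (hω : ω ∈ S.topSphere b) : S.Q ω ∈ dualityMap b := by
  rw [mem_topSphere_iff _ (norm_eq_of_mem_sphere b)] at hω
  refine (mem_dualityMap_iff _ _).2 ⟨?_, hω.2⟩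
  have := S.norm_Q_le ω
  rwa [hω.1, one_pow] at this

/-- Compare `g (b + t x) ≤ ‖b + t x‖ = Q ω (b + t x)` with `Q ω b ≤ 1 = g b`: a maximiser for the
perturbed operator dominates every `g ∈ D(b)` in the direction `x` and almost maximises at `b`. -/
theorem perturbation_estimate (S : QuadSetting 𝕜 X H) (b : Metric.sphere (0 : S.XQ) 1)
    {g : StrongDual ℝ S.XQ} (hg : g ∈ dualityMap b) {x : S.XQ} {t : ℝ} (ht : 0 < t) {ω : H}
    (hω : ‖ω‖ = 1) (h : S.Q ω (b + t • x) = ‖(b : S.XQ) + t • x‖) :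
    g x ≤ S.Q ω x ∧ 1 - 2 * t * ‖x‖ ≤ S.Q ω b := by
  have h1 : g (b + t • x) ≤ ‖(b : S.XQ) + t • x‖ := by
    have := (le_abs_self _).trans (g.le_opNorm (b + t • x))
    rwa [hg.1, one_mul] at this
  rw [← h, map_add, map_add, map_smul, map_smul, hg.2, smul_eq_mul, smul_eq_mul] at h1
  have h2 : S.Q ω b ≤ 1 := (S.Q_apply_le hω b).trans_eq (norm_eq_of_mem_sphere b)
  have h3 : -‖x‖ ≤ g x := by
    have := (neg_abs_le _).trans' (neg_le_neg (g.le_opNorm x))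
    rwa [hg.1, one_mul] at this
  have h4 := S.Q_apply_le hω x
  constructor <;> nlinarith

theorem finiteDimensional_eigenspace (S : QuadSetting 𝕜 X H) (b : S.XQ) :
    FiniteDimensional 𝕜 (Module.End.eigenspace (S.opQ b : H →ₗ[𝕜] H) 1) :=
  ContinuousLinearMap.finite_dimensional_eigenspace (S.isCompactOperator_opQ b) 1 one_ne_zero

theorem mem_eigenspace_of_mem_topSphere (S : QuadSetting 𝕜 X H) {b : S.XQ} {ω : H}
    (hω : ω ∈ S.topSphere b) : ω ∈ Module.End.eigenspace (S.opQ b : H →ₗ[𝕜] H) 1 := by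
  rw [Module.End.mem_eigenspace_iff, one_smul]
  exact hω.2

/-- Expand `Q` in a basis through its polar form. That form is only real-bilinear, so the imaginary
parts of the coefficients need the second family, with `I`. -/
theorem exists_finiteDimensional_Q_mem (S : QuadSetting 𝕜 X H) (V : Submodule 𝕜 H)
    [FiniteDimensional 𝕜 V] : ∃ F : Submodule ℝ (StrongDual ℝ S.XQ),
      FiniteDimensional ℝ F ∧ ∀ ω ∈ V, S.Q ω ∈ F := by
  let e := Module.finBasis 𝕜 V
  let F₁ : Submodule ℝ (StrongDual ℝ S.XQ) := Submodule.span ℝ (Set.range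
    fun p : Fin (Module.finrank 𝕜 V) × Fin (Module.finrank 𝕜 V) =>
      S.polar (e p.1 : H) (e p.2 : H))
  let F₂ : Submodule ℝ (StrongDual ℝ S.XQ) := Submodule.span ℝ (Set.range
    fun p : Fin (Module.finrank 𝕜 V) × Fin (Module.finrank 𝕜 V) =>
      S.polar (e p.1 : H) ((RCLike.I : 𝕜) • (e p.2 : H)))
  have hF₁ : FiniteDimensional ℝ F₁ := FiniteDimensional.span_of_finite ℝ (Set.finite_range _)
  have hF₂ : FiniteDimensional ℝ F₂ := FiniteDimensional.span_of_finite ℝ (Set.finite_range _)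
  have hP : ∀ (i j) (z : 𝕜), S.polar (e i : H) (z • (e j : H)) ∈ F₁ ⊔ F₂ := fun i j z => by
    rw [← RCLike.re_add_im z, add_smul, polar_add_right, mul_smul, polar_smul_right,
      polar_smul_right]
    exact add_mem (Submodule.mem_sup_left (F₁.smul_mem _ (Submodule.subset_span ⟨(i, j), rfl⟩)))
      (Submodule.mem_sup_right (F₂.smul_mem _ (Submodule.subset_span ⟨(i, j), rfl⟩)))
  refine ⟨F₁ ⊔ F₂, inferInstance, fun ω hω => ?_⟩
  have hsum : ω = ∑ i, e.repr ⟨ω, hω⟩ i • (e i : H) := by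
    have := congrArg V.subtype (e.sum_repr ⟨ω, hω⟩)
    simp only [map_sum, map_smul] at this
    exact this.symm
  have hleft : ∀ (s : Finset (Fin (Module.finrank 𝕜 V))) (f : Fin (Module.finrank 𝕜 V) → H)
      (φ : H), S.polar (∑ i ∈ s, f i) φ = ∑ i ∈ s, S.polar (f i) φ := fun s f φ => by
    ext b; simp [polar_apply, sum_inner]
  have hright : ∀ (s : Finset (Fin (Module.finrank 𝕜 V))) (f : Fin (Module.finrank 𝕜 V) → H)
      (φ : H), S.polar φ (∑ i ∈ s, f i) = ∑ i ∈ s, S.polar φ (f i) := fun s f φ => by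
    ext b; simp [polar_apply, inner_sum]
  have hmove : ∀ (z : 𝕜) (x y : H), S.polar (z • x) y = S.polar x (starRingEnd 𝕜 z • y) := by
    intro z x y
    ext b; simp [polar_apply, inner_smul_left, inner_smul_right]
  rw [Q_eq_polar, hsum, hleft]
  refine sum_mem fun i _ => ?_
  rw [hright]
  refine sum_mem fun j _ => ?_
  rw [hmove, smul_smul]
  exact hP _ _ _

theorem isCompact_convexHull_Q (S : QuadSetting 𝕜 X H) {b : S.XQ} (hb : ‖b‖ = 1) :
    IsCompact (convexHull ℝ (S.Q '' S.topSphere b)) := by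
  have := S.finiteDimensional_eigenspace b
  obtain ⟨F, hF, hQ⟩ :=
    S.exists_finiteDimensional_Q_mem (Module.End.eigenspace (S.opQ b : H →ₗ[𝕜] H) 1)
  refine ((S.isCompact_topSphere hb).image S.continuous_Q).convexHull_of_subset_submodule
    (F := F) ?_
  rintro _ ⟨ω, hω, rfl⟩
  exact hQ ω (S.mem_eigenspace_of_mem_topSphere hω)

/-- If `x` separated `h ∈ D(b)` from the hull, the maximisers for `b + t x` would converge, as `t →
0+`, to a top eigenvector `ω'` with `h x ≤ Q ω' x`. -/
theorem dualityMap_eq_convexHull (S : QuadSetting 𝕜 X H) (b : Metric.sphere (0 : S.XQ) 1) :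
    dualityMap b = convexHull ℝ (S.Q '' S.topSphere b) := by
  have hb : ‖(b : S.XQ)‖ = 1 := norm_eq_of_mem_sphere b
  apply Set.Subset.antisymm
  · intro h hh
    by_contra hC
    obtain ⟨x, r, h1, h2⟩ := StrongDual.exists_lt_of_notMem_isCompact (convex_convexHull ℝ _)
      (S.isCompact_convexHull_Q hb) hC
    let t : ℕ → ℝ := fun n => 1 / ((n : ℝ) + 1)
    have ht : ∀ n, 0 < t n := fun n => by positivity
    choose ω hω hωn using fun n => S.exists_Q_apply_eq_norm hb (b + t n • x)
    have h3 := fun n => S.perturbation_estimate b hh (ht n) (hω n) (hωn n)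
    have hQ : Tendsto (fun n => S.Q (ω n) b) atTop (𝓝 1) := by
      refine tendsto_of_tendsto_of_tendsto_of_le_of_le ?_ tendsto_const_nhds (fun n => (h3 n).2)
        (fun n => (S.Q_apply_le (hω n) b).trans_eq hb)
      have := ((tendsto_one_div_add_atTop_nhds_zero_nat (𝕜 := ℝ)).const_mul 2).mul_const ‖x‖
        |>.const_sub 1
      simpa [t] using this
    obtain ⟨ω', h4, h5⟩ := S.exists_tendsto_topSphere hb (hyperfilter ℕ) (.of_forall hω)
      (hQ.mono_left Nat.hyperfilter_le_atTop)
    have h6 : Tendsto (fun n => S.Q (ω n) x) (hyperfilter ℕ) (𝓝 (S.Q ω' x)) :=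
      (((ContinuousLinearMap.apply ℝ ℝ x).continuous.comp S.continuous_Q).tendsto ω').comp h5
    have h7 : h x ≤ S.Q ω' x := ge_of_tendsto' h6 fun n => (h3 n).1
    exact lt_irrefl _ ((h7.trans_lt (h1 _ (subset_convexHull ℝ _ ⟨ω', h4, rfl⟩))).trans h2)
  · refine convexHull_min ?_ (convex_dualityMap b)
    rintro _ ⟨ω, hω, rfl⟩
    exact S.Q_mem_dualityMap b hω

theorem isCompact_dualityMap (S : QuadSetting 𝕜 X H) (b : Metric.sphere (0 : S.XQ) 1) :
    IsCompact (dualityMap b) := by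
  rw [dualityMap_eq_convexHull]
  exact S.isCompact_convexHull_Q (norm_eq_of_mem_sphere b)

theorem finiteDimensional_direction_dualityMap (S : QuadSetting 𝕜 X H)
    (b : Metric.sphere (0 : S.XQ) 1) :
    FiniteDimensional ℝ (affineSpan ℝ (dualityMap b)).direction := by
  have := S.finiteDimensional_eigenspace (b : S.XQ)
  obtain ⟨F, hF, hQ⟩ :=
    S.exists_finiteDimensional_Q_mem (Module.End.eigenspace (S.opQ b : H →ₗ[𝕜] H) 1)
  refine Submodule.finiteDimensional_of_le (S₂ := F) ?_
  rw [dualityMap_eq_convexHull, affineSpan_convexHull, direction_affineSpan]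
  refine Submodule.span_le.2 ?_
  rintro _ ⟨_, ⟨ω, hω, rfl⟩, _, ⟨γ, hγ, rfl⟩, rfl⟩
  exact F.sub_mem (hQ _ (S.mem_eigenspace_of_mem_topSphere hω))
    (hQ _ (S.mem_eigenspace_of_mem_topSphere hγ))

theorem dualityMap_inter_image_A (S : QuadSetting 𝕜 X H) (b : Metric.sphere (0 : S.XQ) 1) :
    dualityMap b ∩ S.Q '' S.A = S.Q '' S.topSphere b := by
  have hb : ‖(b : S.XQ)‖ = 1 := norm_eq_of_mem_sphere b
  ext h
  constructor
  · rintro ⟨h1, ω, h2, rfl⟩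
    exact ⟨ω, (S.mem_topSphere_iff hb).2 ⟨h2.1, h1.2⟩, rfl⟩
  · rintro ⟨ω, hω, rfl⟩
    have h1 := S.Q_mem_dualityMap b hω
    exact ⟨h1, ω, ⟨hω.1, h1.1⟩, rfl⟩

theorem extremePoints_dualityMap_subset (S : QuadSetting 𝕜 X H)
    (b : Metric.sphere (0 : S.XQ) 1) :
    Set.extremePoints ℝ (dualityMap b) ⊆ dualityMap b ∩ S.Q '' S.A := by
  rw [dualityMap_inter_image_A, dualityMap_eq_convexHull]
  exact extremePoints_convexHull_subset

/-- Normalise the segment from `ω` to `γ`. It meets 0 only when `γ = -ω`, and `Q` identifies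
antipodes. -/
theorem joinedIn_Q_image_topSphere (S : QuadSetting 𝕜 X H) {b : S.XQ} {ω γ : H}
    (hω : ω ∈ S.topSphere b) (hγ : γ ∈ S.topSphere b) :
    JoinedIn (S.Q '' S.topSphere b) (S.Q ω) (S.Q γ) := by
  by_cases hneg : γ = -ω
  · have h : S.Q γ = S.Q ω := by
      have := S.Q_smul_of_norm_one (c := (-1 : 𝕜)) (by simp) ω
      rwa [neg_one_smul, ← hneg] at this
    rw [h]
    exact JoinedIn.refl ⟨ω, hω, rfl⟩
  · let p : ℝ → H := fun t => ((1 - t : ℝ) : 𝕜) • ω + ((t : ℝ) : 𝕜) • γ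
    have hp : ∀ t ∈ Set.Icc (0 : ℝ) 1, p t ≠ 0 := fun t ht h0 => by
      have h1 : ((t : ℝ) : 𝕜) • γ = -(((1 - t : ℝ) : 𝕜) • ω) := eq_neg_of_add_eq_zero_right h0
      have h2 := congrArg norm h1
      rw [norm_neg, norm_smul, norm_smul, hω.1, hγ.1, RCLike.norm_ofReal, RCLike.norm_ofReal,
        abs_of_nonneg ht.1, abs_of_nonneg (by linarith [ht.2])] at h2
      have h3 : t = 1 / 2 := by linarith
      have h4 : 1 - t = t := by linarith
      rw [h4, ← smul_neg] at h1
      have h5 : ((t : ℝ) : 𝕜) ≠ 0 := by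
        rw [RCLike.ofReal_ne_zero, h3]; norm_num
      exact hneg (smul_right_injective H h5 h1)
    have hpc : Continuous p := by fun_prop
    have hQc : ContinuousOn (fun t => (‖p t‖⁻¹) ^ 2 • S.Q (p t)) (Set.Icc 0 1) := by
      refine ContinuousOn.smul (ContinuousOn.pow (ContinuousOn.inv₀ hpc.norm.continuousOn
        fun t ht => norm_ne_zero_iff.2 (hp t ht)) 2) (S.continuous_Q.comp hpc).continuousOn
    refine JoinedIn.ofLine (f := fun t => (‖p t‖⁻¹) ^ 2 • S.Q (p t)) hQc ?_ ?_ ?_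
    · simp [p, hω.1]
    · simp [p, hγ.1]
    · rintro _ ⟨t, ht, rfl⟩
      have h0 := norm_ne_zero_iff.2 (hp t ht)
      refine ⟨((‖p t‖⁻¹ : ℝ) : 𝕜) • p t, ⟨?_, ?_⟩, S.Q_real_smul _ _⟩
      · rw [norm_smul, RCLike.norm_ofReal, abs_of_nonneg (by positivity), inv_mul_cancel₀ h0]
      · simp only [p, map_smul, map_add, hω.2, hγ.2]

theorem isPathConnected_dualityMap_inter (S : QuadSetting 𝕜 X H)
    (b : Metric.sphere (0 : S.XQ) 1) : IsPathConnected (dualityMap b ∩ S.Q '' S.A) := by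
  rw [dualityMap_inter_image_A]
  obtain ⟨ω, hω⟩ := S.topSphere_nonempty (norm_eq_of_mem_sphere b)
  refine ⟨S.Q ω, ⟨ω, hω, rfl⟩, ?_⟩
  rintro _ ⟨γ, hγ, rfl⟩
  exact S.joinedIn_Q_image_topSphere hω hγ

end QuadSetting

/-! ### Weak* against norm convergence, and upper semicontinuity of `D`. -/

theorem normEqWeakStarOn_of_ultrafilter {E : Type*} [NormedAddCommGroup E] [NormedSpace ℝ E]
    {s : Set (StrongDual ℝ E)}
    (h : ∀ (u : Ultrafilter s) (f : s),
      (∀ x : E, Filter.Tendsto (fun g : s => (g : StrongDual ℝ E) x) u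
        (𝓝 ((f : StrongDual ℝ E) x))) →
      Filter.Tendsto (fun g : s => (g : StrongDual ℝ E)) u (𝓝 (f : StrongDual ℝ E))) :
    NormEqWeakStarOn s := by
  refine le_antisymm ?_ (le_of_nhds_le_nhds fun f => ?_)
  · rw [← continuous_iff_le_induced]
    exact NormedSpace.Dual.toWeakDual_continuous.comp continuous_subtype_val
  · rw [nhds_induced, nhds_induced, Filter.le_iff_ultrafilter]
    intro u hu
    rw [← Filter.tendsto_iff_comap] at hu ⊢
    exact h u f fun x => ((WeakDual.eval_continuous x).tendsto _).comp hu

theorem one_sub_norm_le_of_mem_dualityMap {E : Type*} [NormedAddCommGroup E] [NormedSpace ℝ E]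
    {a : Metric.sphere (0 : E) 1} {h : StrongDual ℝ E} (hh : h ∈ dualityMap a) (b : E) :
    1 - ‖(a : E) - b‖ ≤ h b := by
  have := (le_abs_self _).trans (h.le_opNorm (a - b))
  rw [map_sub, hh.1, hh.2, one_mul] at this
  linarith

namespace QuadSetting
open Filter

variable {𝕜 : Type*} [RCLike 𝕜]
  {X : Type*} [NormedAddCommGroup X] [NormedSpace ℝ X]
  {H : Type*} [NormedAddCommGroup H] [InnerProductSpace 𝕜 H] [CompleteSpace H]

theorem normEqWeakStarOn_image_A (S : QuadSetting 𝕜 X H) : NormEqWeakStarOn (S.Q '' S.A) := by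
  refine normEqWeakStarOn_of_ultrafilter fun u f hu => ?_
  choose ω hω hQ using fun g : S.Q '' S.A => g.2
  obtain ⟨ω', h1, h2, h3⟩ := S.exists_limit u (.of_forall fun g => (hω g).1)
  have h4 : S.Q ω' = f := by
    ext b
    refine tendsto_nhds_unique (h2 b) ?_
    simp_rw [hQ]
    exact hu b
  have h5 : ‖S.Q ω'‖ = 1 := by rw [h4, ← hQ f]; exact (hω f).2
  have h6 : 1 ≤ ‖ω'‖ := by nlinarith [S.norm_Q_le ω', norm_nonneg ω']
  have h7 := (S.continuous_Q.tendsto ω').comp (h3 h6)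
  rw [h4] at h7
  exact h7.congr hQ

theorem exists_delta_topSphere (S : QuadSetting 𝕜 X H) {b : S.XQ} (hb : ‖b‖ = 1) {ε : ℝ}
    (hε : 0 < ε) : ∃ δ > 0, ∀ ω : H, ‖ω‖ = 1 → 1 - δ < S.Q ω b →
      ∃ ω' ∈ S.topSphere b, ‖ω - ω'‖ < ε := by
  by_contra! hcon
  choose ω h1 h2 h3 using fun n : ℕ => hcon (1 / ((n : ℝ) + 1)) (by positivity)
  have hQ : Tendsto (fun n => S.Q (ω n) b) atTop (𝓝 1) := by
    refine tendsto_of_tendsto_of_tendsto_of_le_of_le ?_ tendsto_const_nhds (fun n => (h2 n).le)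
      (fun n => (S.Q_apply_le (h1 n) b).trans_eq hb)
    simpa using tendsto_one_div_add_atTop_nhds_zero_nat.const_sub (1 : ℝ)
  obtain ⟨ω', h4, h5⟩ := S.exists_tendsto_topSphere hb (hyperfilter ℕ) (.of_forall h1)
    (hQ.mono_left Nat.hyperfilter_le_atTop)
  rw [tendsto_iff_norm_sub_tendsto_zero] at h5
  obtain ⟨n, hn⟩ := (h5.eventually_lt_const hε).exists
  exact absurd hn (h3 n ω' h4).not_gt

/-- On `Q(sphere)`, the distance to `D(b)` is bounded by an affine function of `h`. Such a bound
survives convex combinations because `D(b)` is convex, so it extends to the hull. -/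
theorem exists_delta_dualityMap (S : QuadSetting 𝕜 X H) (b : Metric.sphere (0 : S.XQ) 1) {ε : ℝ}
    (hε : 0 < ε) : ∃ δ > 0, ∀ h ∈ convexHull ℝ (S.Q '' Metric.sphere 0 1), 1 - δ < h b →
      ∃ g ∈ dualityMap b, ‖h - g‖ < ε := by
  have hb : ‖(b : S.XQ)‖ = 1 := norm_eq_of_mem_sphere b
  -- On unit vectors `Q` is 2-Lipschitz, so `ε / 4` becomes the `ε / 2` of the affine bound.
  obtain ⟨δ, hδ, hδ'⟩ := S.exists_delta_topSphere hb (ε := ε / 4) (by positivity)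
  have hsub : convexHull ℝ (S.Q '' Metric.sphere 0 1) ⊆
      {h | ∃ g ∈ dualityMap b, ‖h - g‖ ≤ ε / 2 + 2 / δ * (1 - h b)} := by
    refine convexHull_min ?_ ?_
    · rintro _ ⟨ω, hω, rfl⟩
      have hω' : ‖ω‖ = 1 := by simpa using hω
      have hle : 0 ≤ 1 - S.Q ω b := by linarith [S.Q_apply_le hω' b]
      by_cases hlt : 1 - δ < S.Q ω b
      · obtain ⟨γ, h1, h2⟩ := hδ' ω hω' hlt
        refine ⟨S.Q γ, S.Q_mem_dualityMap b h1, (S.norm_Q_sub_le ω γ).trans ?_⟩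
        rw [hω', h1.1]
        have : 0 ≤ 2 / δ * (1 - S.Q ω b) := by positivity
        linarith
      · obtain ⟨γ, hγ⟩ := S.topSphere_nonempty hb
        refine ⟨S.Q γ, S.Q_mem_dualityMap b hγ, (norm_sub_le _ _).trans ?_⟩
        have h1 := S.norm_Q_le ω
        have h2 := S.norm_Q_le γ
        rw [hω'] at h1
        rw [hγ.1] at h2
        -- Away from the maximum, the slope `2 / δ` makes the bound exceed the trivial distance
        -- estimate 2.
        have h3 : 2 ≤ 2 / δ * (1 - S.Q ω b) := by
          rw [div_mul_eq_mul_div, le_div_iff₀ hδ]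
          linarith
        linarith
    · rintro f ⟨f', hf, hf'⟩ g ⟨g', hg, hg'⟩ s t hs ht hst
      refine ⟨s • f' + t • g', convex_dualityMap b hf hg hs ht hst, ?_⟩
      have h1 : s • f + t • g - (s • f' + t • g') = s • (f - f') + t • (g - g') := by
        module
      rw [h1]
      refine (norm_add_le _ _).trans ?_
      rw [norm_smul, norm_smul, Real.norm_of_nonneg hs, Real.norm_of_nonneg ht]
      refine (add_le_add (mul_le_mul_of_nonneg_left hf' hs)
        (mul_le_mul_of_nonneg_left hg' ht)).trans_eq ?_
      simp only [add_apply, smul_apply, smul_eq_mul]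
      linear_combination (ε / 2 + 2 / δ) * hst
  refine ⟨δ * ε / 4, by positivity, fun h hh hlt => ?_⟩
  obtain ⟨g, hg, hg'⟩ := hsub hh
  refine ⟨g, hg, hg'.trans_lt ?_⟩
  have h1 : 2 / δ * (1 - h b) < 2 / δ * (δ * ε / 4) :=
    mul_lt_mul_of_pos_left (by linarith) (by positivity)
  have h2 : 2 / δ * (δ * ε / 4) = ε / 2 := by field_simp; norm_num
  linarith

theorem dualityMap_subset_convexHull (S : QuadSetting 𝕜 X H)
    (b : Metric.sphere (0 : S.XQ) 1) :
    dualityMap b ⊆ convexHull ℝ (S.Q '' Metric.sphere 0 1) := by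
  rw [dualityMap_eq_convexHull]
  exact convexHull_mono (Set.image_mono fun ω hω => by simpa using hω.1)

theorem isCusco_dualityMap (S : QuadSetting 𝕜 X H) :
    IsCusco (fun b : Metric.sphere (0 : S.XQ) 1 => dualityMap b) := by
  intro b
  refine ⟨convex_dualityMap b, ?_, S.isCompact_dualityMap b, fun V hV hbV => ?_⟩
  · obtain ⟨γ, hγ⟩ := S.topSphere_nonempty (norm_eq_of_mem_sphere b)
    exact ⟨_, S.Q_mem_dualityMap b hγ⟩
  · obtain ⟨ε, hε, hεV⟩ := (S.isCompact_dualityMap b).exists_thickening_subset_open hV hbV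
    obtain ⟨δ, hδ, hδ'⟩ := S.exists_delta_dualityMap b hε
    refine ⟨Metric.ball b δ, Metric.ball_mem_nhds b hδ, fun a ha h hh => hεV ?_⟩
    have ha' : ‖(a : S.XQ) - b‖ < δ := by
      rw [← dist_eq_norm]; exact ha
    obtain ⟨g, hg, hg'⟩ := hδ' h (S.dualityMap_subset_convexHull a hh)
      (by linarith [one_sub_norm_le_of_mem_dualityMap hh (b : S.XQ)])
    exact Metric.mem_thickening_iff.2 ⟨g, hg, by rwa [dist_eq_norm]⟩

theorem normEqWeakStarOn_normAttaining (S : QuadSetting 𝕜 X H) :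
    NormEqWeakStarOn (normAttaining S.XQ) := by
  refine normEqWeakStarOn_of_ultrafilter fun u f hu => ?_
  obtain ⟨b, hb⟩ := Set.mem_iUnion.1 f.2
  have hub : Tendsto (fun g : normAttaining S.XQ => (g : StrongDual ℝ S.XQ) b) u (𝓝 1) := by
    have := hu b
    rwa [hb.2] at this
  have hdist : ∀ ε > 0, ∀ᶠ g : normAttaining S.XQ in u, ∃ g' ∈ dualityMap b,
      ‖(g : StrongDual ℝ S.XQ) - g'‖ < ε := fun ε hε => by
    obtain ⟨δ, hδ, hδ'⟩ := S.exists_delta_dualityMap b hε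
    filter_upwards [hub.eventually_const_lt (show 1 - δ < 1 by linarith)] with g hg
    obtain ⟨a, ha⟩ := Set.mem_iUnion.1 g.2
    exact hδ' g (S.dualityMap_subset_convexHull a ha) hg
  -- Nearest points in the compact set `D(b)` form a family that converges along the ultrafilter,
  -- and its limit is also the limit of the original functionals.
  have hex : ∀ g : normAttaining S.XQ, ∃ g' ∈ dualityMap b,
      ∀ g'' ∈ dualityMap b, ‖(g : StrongDual ℝ S.XQ) - g'‖ ≤ ‖(g : StrongDual ℝ S.XQ) - g''‖ :=
    fun g => by
      obtain ⟨q, hq, hmin⟩ := (S.isCompact_dualityMap b).exists_isMinOn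
        (f := fun q => ‖(g : StrongDual ℝ S.XQ) - q‖) ⟨f, hb⟩
        (Continuous.continuousOn (by fun_prop))
      exact ⟨q, hq, fun _ h => hmin h⟩
  choose p hp hpmin using hex
  have hp0 : Tendsto (fun g : normAttaining S.XQ => (g : StrongDual ℝ S.XQ) - p g) u (𝓝 0) := by
    rw [Metric.tendsto_nhds]
    intro ε hε
    filter_upwards [hdist ε hε] with g hg
    obtain ⟨g', hg', hlt⟩ := hg
    rw [dist_zero_right]
    exact (hpmin g g' hg').trans_lt hlt
  obtain ⟨q, -, hq⟩ := (S.isCompact_dualityMap b).ultrafilter_le_nhds (u.map p)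
    (le_principal_iff.2 (Filter.mem_map.2 (Filter.univ_mem' hp)))
  have hlim : Tendsto (fun g : normAttaining S.XQ => (g : StrongDual ℝ S.XQ)) u (𝓝 q) := by
    have hq' : Tendsto p u (𝓝 q) := hq
    simpa using hp0.add hq'
  have hqf : q = f := by
    ext x
    exact tendsto_nhds_unique
      (((ContinuousLinearMap.apply ℝ ℝ x).continuous.tendsto q).comp hlim) (hu x)
  rwa [hqf] at hlim

end QuadSetting

/-! ### Fréchet differentiability and generic simplicity of the top eigenvalue. -/

theorem hasDerivAt_add_smul_add_sq_smul {E : Type*} [NormedAddCommGroup E] [NormedSpace ℝ E]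
    (a p q : E) : HasDerivAt (fun t : ℝ => a + t • p + t ^ 2 • q) p 0 := by
  have h1 : HasDerivAt (fun t : ℝ => t • p) ((1 : ℝ) • p) 0 :=
    (hasDerivAt_id (0 : ℝ)).smul_const p
  have h2 := (hasDerivAt_pow 2 (0 : ℝ)).smul_const q
  have h3 := (h1.const_add a).add h2
  norm_num at h3
  exact h3

theorem Submodule.exists_orthonormal_of_le_finrank {𝕜 H : Type*} [RCLike 𝕜]
    [NormedAddCommGroup H] [InnerProductSpace 𝕜 H] (V : Submodule 𝕜 H)
    [FiniteDimensional 𝕜 V] {k : ℕ} (hk : k ≤ Module.finrank 𝕜 V) :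
    ∃ v : Fin k → H, Orthonormal 𝕜 v ∧ ∀ j, v j ∈ V := by
  refine ⟨fun j => (stdOrthonormalBasis 𝕜 V (Fin.castLE hk j) : H), ?_, fun j => SetLike.coe_mem _⟩
  exact ((stdOrthonormalBasis 𝕜 V).orthonormal.comp_linearIsometry V.subtypeₗᵢ).comp _
    (Fin.castLE_injective hk)

theorem Orthonormal.le_finrank {𝕜 H : Type*} [RCLike 𝕜] [NormedAddCommGroup H]
    [InnerProductSpace 𝕜 H] {V : Submodule 𝕜 H} [FiniteDimensional 𝕜 V] {k : ℕ}
    {v : Fin k → H} (hv : Orthonormal 𝕜 v) (hV : ∀ j, v j ∈ V) : k ≤ Module.finrank 𝕜 V := by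
  have h1 := finrank_span_eq_card hv.linearIndependent
  rw [Fintype.card_fin] at h1
  rw [← h1]
  refine Submodule.finrank_mono (Submodule.span_le.2 ?_)
  rintro _ ⟨j, rfl⟩
  exact hV j

theorem Orthonormal.norm_sum_smul_eq {𝕜 H : Type*} [RCLike 𝕜] [NormedAddCommGroup H]
    [InnerProductSpace 𝕜 H] {k : ℕ} {v w : Fin k → H} (hv : Orthonormal 𝕜 v)
    (hw : Orthonormal 𝕜 w) (c : Fin k → 𝕜) : ‖∑ j, c j • v j‖ = ‖∑ j, c j • w j‖ := by
  rw [@norm_eq_sqrt_re_inner 𝕜, @norm_eq_sqrt_re_inner 𝕜 _ _ _ _ (∑ j, c j • w j),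
    hv.inner_sum, hw.inner_sum]

namespace QuadSetting
open Filter

variable {𝕜 : Type*} [RCLike 𝕜]
  {X : Type*} [NormedAddCommGroup X] [NormedSpace ℝ X]
  {H : Type*} [NormedAddCommGroup H] [InnerProductSpace 𝕜 H] [CompleteSpace H]

theorem Q'_eq (S : QuadSetting 𝕜 X H) (ω φ : H) : S.Q' ω φ = (2 : ℝ) • S.polar ω φ := by
  have h : (fun t : ℝ => S.Q (ω + (t : 𝕜) • φ)) =
      fun t : ℝ => S.Q ω + t • ((2 : ℝ) • S.polar ω φ) + t ^ 2 • S.Q φ := by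
    ext1 t
    rw [Q_add, polar_smul_right, Q_real_smul, smul_comm]
  rw [Q', h]
  exact (hasDerivAt_add_smul_add_sq_smul _ _ _).deriv

/-- The derivative is the unique `h ∈ D(b)`. The remainder is nonnegative since `h x ≤ ‖x‖`, and at
most `(Q ω - h) (x - b)` for a maximiser `ω` at `x`, where `Q ω` is close to `h`. -/
theorem differentiableAt_norm_of_dualityMap_eq_singleton (S : QuadSetting 𝕜 X H)
    (b : Metric.sphere (0 : S.XQ) 1) {h : StrongDual ℝ S.XQ} (hb : dualityMap b = {h}) :
    DifferentiableAt ℝ (fun x : S.XQ => ‖x‖) (b : S.XQ) := by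
  have hb1 : ‖(b : S.XQ)‖ = 1 := norm_eq_of_mem_sphere b
  have hh : h ∈ dualityMap b := hb ▸ rfl
  suffices HasFDerivAt (fun x : S.XQ => ‖x‖) h (b : S.XQ) from this.differentiableAt
  refine HasFDerivAt.of_isLittleO (Asymptotics.isLittleO_iff.2 fun c hc => ?_)
  obtain ⟨δ, hδ, hδ'⟩ := S.exists_delta_dualityMap b hc
  -- The radius is `δ / 2` because the maximiser at `x` satisfies only `Q ω b ≥ 1 - 2 ‖x - b‖`.
  filter_upwards [Metric.ball_mem_nhds (b : S.XQ) (half_pos hδ)] with x hx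
  rw [Metric.mem_ball, dist_eq_norm] at hx
  obtain ⟨ω, hω, hωx⟩ := S.exists_Q_apply_eq_norm hb1 x
  have h1 : S.Q ω x = S.Q ω b + S.Q ω (x - b) := by rw [map_sub]; ring
  have h2 : 1 - ‖x - b‖ ≤ ‖x‖ := by
    have := norm_sub_norm_le (b : S.XQ) x
    rw [hb1, norm_sub_rev] at this
    linarith
  have h3 := S.Q_apply_le hω (x - b)
  have h4 := S.Q_apply_le hω b
  obtain ⟨g, hg, hlt⟩ := hδ' (S.Q ω) (subset_convexHull ℝ _ ⟨ω, by simpa using hω, rfl⟩)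
    (by linarith)
  rw [hb, Set.mem_singleton_iff] at hg
  subst hg
  have h5 : (S.Q ω - g) (x - b) ≤ c * ‖x - b‖ :=
    (le_abs_self _).trans (((S.Q ω - g).le_opNorm _).trans (by gcongr))
  rw [sub_apply] at h5
  have h6 : g x ≤ ‖x‖ := by
    have := (le_abs_self _).trans (g.le_opNorm x)
    rwa [hh.1, one_mul] at this
  have h7 : g (x - b) = g x - 1 := by rw [map_sub, hh.2]
  rw [hb1] at h4 ⊢
  rw [Real.norm_of_nonneg (by linarith)]
  linarith

/-- The eigenspace of `T_b` for the eigenvalue `1`. -/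
noncomputable def topSpace (S : QuadSetting 𝕜 X H) (b : S.XQ) : Submodule 𝕜 H :=
  Module.End.eigenspace (S.opQ b : H →ₗ[𝕜] H) 1

instance (S : QuadSetting 𝕜 X H) (b : S.XQ) : FiniteDimensional 𝕜 (S.topSpace b) :=
  S.finiteDimensional_eigenspace b

theorem mem_topSpace_iff (S : QuadSetting 𝕜 X H) {b : S.XQ} {ω : H} :
    ω ∈ S.topSpace b ↔ S.opQ b ω = ω := by
  rw [topSpace, Module.End.mem_eigenspace_iff, one_smul]
  rfl

theorem mem_topSphere_of_mem_topSpace (S : QuadSetting 𝕜 X H) {b : S.XQ} {ω : H}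
    (h1 : ‖ω‖ = 1) (h2 : ω ∈ S.topSpace b) : ω ∈ S.topSphere b :=
  ⟨h1, S.mem_topSpace_iff.1 h2⟩

theorem exists_tendsto_orthonormal (S : QuadSetting 𝕜 X H) {ι : Type*} (u : Ultrafilter ι)
    {b : Metric.sphere (0 : S.XQ) 1} {β : ι → Metric.sphere (0 : S.XQ) 1}
    (hβ : Tendsto β u (𝓝 b)) {k : ℕ} {v : ι → Fin k → H} (hv : ∀ i, Orthonormal 𝕜 (v i))
    (hvV : ∀ i j, v i j ∈ S.topSpace (β i : S.XQ)) :
    ∃ w : Fin k → H, Orthonormal 𝕜 w ∧ (∀ j, w j ∈ S.topSpace (b : S.XQ)) ∧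
      ∀ j, Tendsto (fun i => v i j) u (𝓝 (w j)) := by
  have hb : ‖(b : S.XQ)‖ = 1 := norm_eq_of_mem_sphere b
  have hsub : Tendsto (fun i => ‖(β i : S.XQ) - b‖) u (𝓝 0) :=
    tendsto_iff_norm_sub_tendsto_zero.1 ((continuous_subtype_val.tendsto b).comp hβ)
  have hlim : ∀ j, ∃ w ∈ S.topSphere (b : S.XQ), Tendsto (fun i => v i j) u (𝓝 w) := fun j => by
    refine S.exists_tendsto_topSphere hb u (.of_forall fun i => (hv i).1 j) ?_
    refine tendsto_of_tendsto_of_tendsto_of_le_of_le (g := fun i => 1 - ‖(β i : S.XQ) - b‖) ?_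
      tendsto_const_nhds (fun i => ?_) (fun i => (S.Q_apply_le ((hv i).1 j) b).trans_eq hb)
    · simpa using hsub.const_sub 1
    · exact one_sub_norm_le_of_mem_dualityMap (S.Q_mem_dualityMap (β i)
        (S.mem_topSphere_of_mem_topSpace ((hv i).1 j) (hvV i j))) b
  choose w hw hvw using hlim
  refine ⟨w, ?_, fun j => S.mem_topSpace_iff.2 (hw j).2, hvw⟩
  rw [orthonormal_iff_ite]
  intro j l
  refine tendsto_nhds_unique ((hvw j).inner (hvw l)) ?_
  simp_rw [fun i => orthonormal_iff_ite.1 (hv i) j l]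
  exact tendsto_const_nhds

/-- Upper semicontinuity of the multiplicity: limits of orthonormal eigenvectors are orthonormal
eigenvectors. -/
theorem isClosed_le_finrank_topSpace (S : QuadSetting 𝕜 X H) (k : ℕ) :
    IsClosed {b : Metric.sphere (0 : S.XQ) 1 |
      k ≤ Module.finrank 𝕜 (S.topSpace (b : S.XQ))} := by
  refine IsSeqClosed.isClosed fun β b hβ hlim => ?_
  choose v hv hvV using fun n => (S.topSpace (β n : S.XQ)).exists_orthonormal_of_le_finrank (hβ n)
  obtain ⟨w, hw, hwV, -⟩ := S.exists_tendsto_orthonormal (hyperfilter ℕ)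
    (hlim.mono_left Nat.hyperfilter_le_atTop) hv hvV
  exact hw.le_finrank hwV

/-- The unit sphere of a line is one orbit of the unit scalars, on which `Q` is constant. -/
theorem dualityMap_eq_singleton (S : QuadSetting 𝕜 X H) (b : Metric.sphere (0 : S.XQ) 1)
    (h : Module.finrank 𝕜 (S.topSpace (b : S.XQ)) ≤ 1) :
    ∃ ω ∈ S.A, dualityMap b = {S.Q ω} := by
  obtain ⟨ω, hω⟩ := S.topSphere_nonempty (norm_eq_of_mem_sphere b)
  refine ⟨ω, ⟨hω.1, (S.Q_mem_dualityMap b hω).1⟩, ?_⟩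
  have himage : S.Q '' S.topSphere (b : S.XQ) = {S.Q ω} := by
    refine Set.Subset.antisymm ?_ (Set.singleton_subset_iff.2 ⟨ω, hω, rfl⟩)
    rintro _ ⟨γ, hγ, rfl⟩
    obtain ⟨e, he⟩ := finrank_le_one_iff.1 h
    obtain ⟨c, hc⟩ := he ⟨ω, S.mem_topSpace_iff.2 hω.2⟩
    obtain ⟨d, hd⟩ := he ⟨γ, S.mem_topSpace_iff.2 hγ.2⟩
    have hc' : c • (e : H) = ω := congrArg Subtype.val hc
    have hd' : d • (e : H) = γ := congrArg Subtype.val hd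
    have hc0 : c ≠ 0 := by
      rintro rfl
      rw [zero_smul] at hc'
      simpa [← hc'] using hω.1
    have hγω : γ = (d / c) • ω := by
      rw [← hc', smul_smul, div_mul_cancel₀ _ hc0, hd']
    have hn := congrArg norm hγω
    rw [norm_smul, hω.1, hγ.1, mul_one] at hn
    rw [hγω, S.Q_smul_of_norm_one hn.symm]
    rfl
  rw [dualityMap_eq_convexHull, himage, convexHull_singleton]

/-- Were `Q` constant on the sphere, its value at `(v 0 + c • v 1) / √2` for orthonormal `v 0`, `v
1` would be `Q (v 0) + polar (v 0) (c • v 1)`. So the polar term, half of `Q'`, would vanish for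
every unit scalar `c`. -/
theorem exists_Q_ne_of_nondegenerate (S : QuadSetting 𝕜 X H) (hS : S.Nondegenerate)
    (b : Metric.sphere (0 : S.XQ) 1) (h : 2 ≤ Module.finrank 𝕜 (S.topSpace (b : S.XQ))) :
    ∃ ω ∈ S.topSphere (b : S.XQ), ∃ γ ∈ S.topSphere (b : S.XQ), S.Q ω ≠ S.Q γ := by
  by_contra! hconst
  obtain ⟨v, hv, hvV⟩ := (S.topSpace (b : S.XQ)).exists_orthonormal_of_le_finrank h
  have hA : ∀ ω ∈ S.topSphere (b : S.XQ), ω ∈ S.A := fun ω hω =>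
    ⟨hω.1, (S.Q_mem_dualityMap b hω).1⟩
  have hv' : ∀ j, v j ∈ S.topSphere (b : S.XQ) := fun j =>
    S.mem_topSphere_of_mem_topSpace (hv.1 j) (hvV j)
  obtain ⟨c, hc, hne⟩ := hS _ (hA _ (hv' 0)) _ (hA _ (hv' 1)) (hconst _ (hv' 0) _ (hv' 1))
  apply hne
  have hinner : inner 𝕜 (v 0) (c • v 1) = 0 := by
    rw [inner_smul_right, hv.2 (by decide), mul_zero]
  have hφ : ‖c • v 1‖ = 1 := by rw [norm_smul, hc, hv.1, one_mul]
  have hr : ((√2)⁻¹ : ℝ) ^ 2 = 1 / 2 := by rw [inv_pow, Real.sq_sqrt (by norm_num), one_div]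
  have hnorm : ‖v 0 + c • v 1‖ = √2 := by
    rw [eq_comm, Real.sqrt_eq_iff_mul_self_eq (by norm_num) (norm_nonneg _), ← pow_two,
      @norm_add_sq 𝕜, hinner, hv.1, hφ]
    norm_num
  have hmem : (((√2)⁻¹ : ℝ) : 𝕜) • (v 0 + c • v 1) ∈ S.topSphere (b : S.XQ) := by
    refine S.mem_topSphere_of_mem_topSpace ?_ (Submodule.smul_mem _ _
      (add_mem (hvV 0) (Submodule.smul_mem _ _ (hvV 1))))
    rw [norm_smul, hnorm, RCLike.norm_ofReal, abs_of_nonneg (by positivity),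
      inv_mul_cancel₀ (by positivity)]
  have hQ := hconst _ hmem _ (hv' 0)
  rw [Q_real_smul, hr, Q_add, S.Q_smul_of_norm_one hc, hconst _ (hv' 1) _ (hv' 0)] at hQ
  rw [Q'_eq]
  have h2 : (2 : ℝ) • S.polar (v 0) (c • v 1) = (2 : ℝ) • ((1 / 2 : ℝ) •
      (S.Q (v 0) + (2 : ℝ) • S.polar (v 0) (c • v 1) + S.Q (v 0)) - S.Q (v 0)) := by
    module
  rw [h2, hQ, sub_self, smul_zero]

/-- Perturb `b` in a direction `x` along which `Q` is not constant on the top sphere. If the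
multiplicity never dropped, every top eigenvector of `b` would be a limit of top eigenvectors of the
perturbations, hence would maximise `Q · x`, making it constant. -/
theorem exists_finrank_topSpace_lt (S : QuadSetting 𝕜 X H) (hS : S.Nondegenerate)
    (b : Metric.sphere (0 : S.XQ) 1) (h : 2 ≤ Module.finrank 𝕜 (S.topSpace (b : S.XQ)))
    {O : Set (Metric.sphere (0 : S.XQ) 1)} (hO : O ∈ 𝓝 b) :
    ∃ a ∈ O, Module.finrank 𝕜 (S.topSpace (a : S.XQ)) <
      Module.finrank 𝕜 (S.topSpace (b : S.XQ)) := by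
  by_contra! hcon
  have hb : ‖(b : S.XQ)‖ = 1 := norm_eq_of_mem_sphere b
  obtain ⟨ω₁, hω₁, ω₂, hω₂, hne⟩ := S.exists_Q_ne_of_nondegenerate hS b h
  obtain ⟨x, hx⟩ : ∃ x, S.Q ω₁ x ≠ S.Q ω₂ x := by
    by_contra! hall
    exact hne (ContinuousLinearMap.ext hall)
  have hstep : ∀ n : ℕ, ∃ (t : ℝ) (a : Metric.sphere (0 : S.XQ) 1), 0 < t ∧ a ∈ O ∧
      dist a b < 1 / ((n : ℝ) + 1) ∧
      (b : S.XQ) + t • x = ‖(b : S.XQ) + t • x‖ • (a : S.XQ) := fun n => by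
    obtain ⟨r, hr, hrO⟩ := Metric.mem_nhds_iff.1 hO
    have h0 : Tendsto (fun t : ℝ => (b : S.XQ) + t • x) (𝓝[>] 0) (𝓝 b) := by
      have : Tendsto (fun t : ℝ => (b : S.XQ) + t • x) (𝓝 0) (𝓝 ((b : S.XQ) + (0 : ℝ) • x)) :=
        Continuous.tendsto (by fun_prop) 0
      rw [zero_smul, add_zero] at this
      exact this.mono_left nhdsWithin_le_nhds
    have h1 : Tendsto (fun t : ℝ => ‖(b : S.XQ) + t • x‖⁻¹ • ((b : S.XQ) + t • x)) (𝓝[>] 0)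
        (𝓝 b) := by
      have := (h0.norm.inv₀ (by rw [hb]; exact one_ne_zero)).smul h0
      rwa [hb, inv_one, one_smul] at this
    have h2 : ∀ᶠ t : ℝ in 𝓝[>] 0, (b : S.XQ) + t • x ≠ 0 :=
      h0.eventually_ne (norm_ne_zero_iff.1 (by rw [hb]; exact one_ne_zero))
    obtain ⟨t, ⟨ht1, ht2⟩, ht3, ht4⟩ := (((h1.eventually (Metric.ball_mem_nhds _ (lt_min hr
      (show 0 < 1 / ((n : ℝ) + 1) by positivity)))).and h2).and self_mem_nhdsWithin |>.exists
      |>.imp fun t ht => (⟨⟨ht.1.1, ht.1.2⟩, ht.2, trivial⟩ : (_ ∧ _) ∧ _ ∧ True))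
    have hn := norm_ne_zero_iff.2 ht2
    refine ⟨t, ⟨‖(b : S.XQ) + t • x‖⁻¹ • ((b : S.XQ) + t • x), ?_⟩, ht3, hrO ?_, ?_, ?_⟩
    · rw [mem_sphere_zero_iff_norm, norm_smul, norm_inv, norm_norm, inv_mul_cancel₀ hn]
    · exact ht1.trans_le (min_le_left _ _)
    · exact ht1.trans_le (min_le_right _ _)
    · rw [smul_smul, mul_inv_cancel₀ hn, one_smul]
  choose t β ht hβO hβ hβt using hstep
  have hβlim : Tendsto β atTop (𝓝 b) := by
    rw [tendsto_iff_dist_tendsto_zero]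
    exact squeeze_zero (fun _ => dist_nonneg) (fun n => (hβ n).le)
      tendsto_one_div_add_atTop_nhds_zero_nat
  choose v hv hvV using fun n =>
    (S.topSpace (β n : S.XQ)).exists_orthonormal_of_le_finrank (hcon _ (hβO n))
  obtain ⟨w, hw, hwV, hvw⟩ := S.exists_tendsto_orthonormal (hyperfilter ℕ)
    (hβlim.mono_left Nat.hyperfilter_le_atTop) hv hvV
  -- Here the assumption that the multiplicity does not drop enters: there are as many limit vectors
  -- as the dimension of the eigenspace.
  have hspan : Submodule.span 𝕜 (Set.range w) = S.topSpace (b : S.XQ) := by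
    refine Submodule.eq_of_le_of_finrank_eq (Submodule.span_le.2 ?_) ?_
    · rintro _ ⟨j, rfl⟩
      exact hwV j
    · rw [finrank_span_eq_card hw.linearIndependent, Fintype.card_fin]
  have hmax : ∀ ω ∈ S.topSphere (b : S.XQ), ∀ γ ∈ S.topSphere (b : S.XQ),
      S.Q γ x ≤ S.Q ω x := fun ω hω γ hγ => by
    have hωw : ω ∈ Submodule.span 𝕜 (Set.range w) := by
      rw [hspan]
      exact S.mem_topSpace_iff.2 hω.2
    obtain ⟨c, rfl⟩ := (Submodule.mem_span_range_iff_exists_fun 𝕜).1 hωw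
    -- Keeping the coefficients of `ω` and replacing the orthonormal family gives unit top
    -- eigenvectors of `β n` that converge to `ω`.
    have hlim : Tendsto (fun n => ∑ j, c j • v n j) (hyperfilter ℕ) (𝓝 (∑ j, c j • w j)) :=
      tendsto_finsetSum _ fun j _ => (hvw j).const_smul (c j)
    have hQlim := (((ContinuousLinearMap.apply ℝ ℝ x).continuous.comp
      S.continuous_Q).tendsto _).comp hlim
    refine ge_of_tendsto' hQlim fun n => ?_
    have hnorm : ‖∑ j, c j • v n j‖ = 1 := ((hv n).norm_sum_smul_eq hw c).trans hω.1
    have hmem : ∑ j, c j • v n j ∈ S.topSphere (β n : S.XQ) :=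
      S.mem_topSphere_of_mem_topSpace hnorm
        (sum_mem fun j _ => Submodule.smul_mem _ _ (hvV n j))
    refine (S.perturbation_estimate b (S.Q_mem_dualityMap b hγ) (ht n) hnorm ?_).1
    have hone := ((S.mem_topSphere_iff (norm_eq_of_mem_sphere (β n))).1 hmem).2
    calc S.Q (∑ j, c j • v n j) (b + t n • x)
        = S.Q (∑ j, c j • v n j) (‖(b : S.XQ) + t n • x‖ • (β n : S.XQ)) := by rw [← hβt]
      _ = ‖(b : S.XQ) + t n • x‖ := by rw [map_smul, hone, smul_eq_mul, mul_one]
  exact hx (le_antisymm (hmax _ hω₂ _ hω₁) (hmax _ hω₁ _ hω₂))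

/-- The multiplicity, being a natural number, has a minimum on each nonempty open set; a minimum of
2 or more could be lowered nearby. -/
theorem dense_finrank_topSpace_le_one (S : QuadSetting 𝕜 X H) (hS : S.Nondegenerate) :
    Dense {b : Metric.sphere (0 : S.XQ) 1 |
      Module.finrank 𝕜 (S.topSpace (b : S.XQ)) ≤ 1} := by
  rw [dense_iff_inter_open]
  intro O hO hne
  let f : Metric.sphere (0 : S.XQ) 1 → ℕ := fun b => Module.finrank 𝕜 (S.topSpace (b : S.XQ))
  obtain ⟨b, hb, hmin⟩ := exists_minimalFor_of_wellFoundedLT (· ∈ O) f hne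
  refine ⟨b, hb, ?_⟩
  by_contra hle
  have h2 : 2 ≤ f b := by
    by_contra h
    exact hle (show f b ≤ 1 by omega)
  obtain ⟨a, ha, hlt⟩ := S.exists_finrank_topSpace_lt hS b h2 (hO.mem_nhds hb)
  exact hlt.not_ge (hmin ha hlt.le)

end QuadSetting

theorem theorem1p6 {𝕜 : Type*} [RCLike 𝕜]
    {X : Type*} [NormedAddCommGroup X] [NormedSpace ℝ X] [CompleteSpace X]
    [TopologicalSpace.SeparableSpace (StrongDual ℝ X)]
    {H : Type*} [NormedAddCommGroup H] [InnerProductSpace 𝕜 H] [CompleteSpace H]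
    (S : QuadSetting 𝕜 X H) :
    -- (i) each `D(b)` is a convex set of finite affine dimension
    (∀ b : Metric.sphere (0 : S.XQ) 1,
      Convex ℝ (dualityMap b) ∧
        FiniteDimensional ℝ (affineSpan ℝ (dualityMap b)).direction) ∧
    -- (ii) extreme points and path-connectedness (in the norm topology)
    (∀ b : Metric.sphere (0 : S.XQ) 1,
      Set.extremePoints ℝ (dualityMap b) ⊆ dualityMap b ∩ S.Q '' S.A ∧
        IsPathConnected (dualityMap b ∩ S.Q '' S.A)) ∧
    -- (iii) topologies on `Q(𝒜)`
    NormEqWeakStarOn (S.Q '' S.A) ∧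
    (S.Nondegenerate →
      -- (iv) singleton faces and Fréchet differentiability on a dense, relatively open set
      (∃ U : Set (Metric.sphere (0 : S.XQ) 1), IsOpen U ∧ Dense U ∧
        ∀ b ∈ U, (∃ ω ∈ S.A, dualityMap b = {S.Q ω}) ∧
          DifferentiableAt ℝ (fun x : S.XQ => ‖x‖) (b : S.XQ)) ∧
      -- (v) the duality mapping is cusco
      IsCusco (fun b : Metric.sphere (0 : S.XQ) 1 => dualityMap b) ∧
      -- (vi) topologies on the set of norm-attaining functionals
      NormEqWeakStarOn (normAttaining S.XQ)) := by
  refine ⟨fun b => ⟨convex_dualityMap b, S.finiteDimensional_direction_dualityMap b⟩,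
    fun b => ⟨S.extremePoints_dualityMap_subset b, S.isPathConnected_dualityMap_inter b⟩,
    S.normEqWeakStarOn_image_A, fun hS => ⟨⟨_, ?_, S.dense_finrank_topSpace_le_one hS,
      fun b hb => ?_⟩, S.isCusco_dualityMap, S.normEqWeakStarOn_normAttaining⟩⟩
  · convert (S.isClosed_le_finrank_topSpace 2).isOpen_compl using 1
    ext b
    exact Nat.lt_succ_iff.symm.trans not_le.symm
  · obtain ⟨ω, hω, hD⟩ := S.dualityMap_eq_singleton b hb
    exact ⟨⟨ω, hω, hD⟩, S.differentiableAt_norm_of_dualityMap_eq_singleton b hD⟩
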